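/- A triple system $\mathrm{TS}(v,\lambda)$ is a pair $(X,\mathcal B)$ in which $X$ is a set of $v$ points and $\mathcal B$ is a finite collection (repetitions allowed) of $3$-subsets of $X$, called blocks, such that every $2$-subset of $X$ is contained in exactly $\lambda$ blocks, counted with multiplicity. A zero-sum $n$-flow of $(X,\mathcal B)$ is a function $f:\mathcal B\to\{\pm1,\dots,\pm(n-1)\}$ (repeated blocks are separate elements of $\mathcal B$ and may receive different values) such that $\sum_{B\in\mathcal B,\;x\in B} f(B)=0$ for every point $x\in X$. Let $v$ and $\lambda$ be natural numbers with $\lambda\equiv 2$ or $4\pmod 6$. 1. If $v\equiv 4\pmod 6$ and $v\neq 4$, then there exists a $\mathrm{TS}(v,\lambda)$ that has a zero-sum $5$-flow. 2. If $v\equiv 1\pmod 6$ and $v\neq 7,19$, then there exists a $\mathrm{TS}(v,\lambda)$ that has a zero-sum $3$-flow. -/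

import Mathlib

/-- `(X, B)` is a `2`-`(v, k, l)` design: `X` has `v` points, every block is a `k`-subset of `X`, and
every `2`-subset of `X` is contained in exactly `l` blocks. The collection of blocks is a finite
family `B : ι → Finset X`, so that blocks may be repeated. -/
def IsTwoDesign {X ι : Type*} [Fintype X] [DecidableEq X] [Fintype ι]
    (B : ι → Finset X) (v k l : ℕ) : Prop :=
  Fintype.card X = v ∧
  (∀ i, (B i).card = k) ∧
  ∀ S : Finset X, S.card = 2 → (Finset.univ.filter fun i => S ⊆ B i).card = l

/-- A triple system `TS(v, l)` is a `2`-`(v, 3, l)` design. -/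
def IsTripleSystem {X ι : Type*} [Fintype X] [DecidableEq X] [Fintype ι]
    (B : ι → Finset X) (v l : ℕ) : Prop :=
  IsTwoDesign B v 3 l

/-- A zero-sum `n`-flow of `(X, B)`: every block (repeated blocks counted separately) has a value in
`{±1, …, ±(n-1)}`, and the values of the blocks through any given point sum to zero. -/
def IsZeroSumFlow {X ι : Type*} [DecidableEq X] [Fintype ι]
    (B : ι → Finset X) (n : ℕ) (f : ι → ℤ) : Prop :=
  (∀ i, 1 ≤ |f i| ∧ |f i| ≤ (n : ℤ) - 1) ∧
  ∀ x : X, ∑ i ∈ Finset.univ.filter (fun i => x ∈ B i), f i = 0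

/-- Some `TS(v, l)` has a zero-sum `n`-flow. -/
def ExistsTripleSystemWithFlow (v l n : ℕ) : Prop :=
  ∃ (X : Type) (_ : Fintype X) (_ : DecidableEq X) (ι : Type) (_ : Fintype ι) (B : ι → Finset X),
    IsTripleSystem B v l ∧ ∃ f : ι → ℤ, IsZeroSumFlow B n f

open Finset

/-! Since λ is even, repeating blocks with their values reduces everything to λ = 2. For v = 6t + 1,
take each block of Skolem's Steiner system (`isTripleSystem_skolem`) once with value 1 and once with
-1. For v = 3n + 1 with n odd, use Bose's mixed blocks twice, again with signs ±1, and put all four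
triples on each column together with infinity (`isTripleSystem_bose`). In a column of weight w, the
values w, w, w through infinity and -2w on the vertical triple cancel at the column's points.
Infinity then only needs weights of total zero, which `columnWeight` supplies for n ≥ 3. -/

/-- Copying every block of a triple system with a flow `m` times. -/
theorem ExistsTripleSystemWithFlow.mul {v l n : ℕ} (h : ExistsTripleSystemWithFlow v l n) (m : ℕ) :
    ExistsTripleSystemWithFlow v (l * m) n := by
  obtain ⟨X, _, _, ι, _, B, ⟨hv, hB, hl⟩, f, hf, hs⟩ := h
  refine ⟨X, inferInstance, inferInstance, ι × Fin m, inferInstance, fun i => B i.1, ⟨hv, fun i => hB i.1, fun S hS => ?_⟩,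
    fun i => f i.1, fun i => hf i.1, fun x => ?_⟩
  · rw [← hl S hS, card_filter, Fintype.sum_prod_type_right, card_filter]
    simp [mul_comm]
  · have := hs x
    rw [sum_filter] at this ⊢
    rw [Fintype.sum_prod_type_right]
    simp [this]

theorem IsTripleSystem.of_pairs {X ι : Type*} [Fintype X] [DecidableEq X] [Fintype ι]
    {B : ι → Finset X} {v l : ℕ} (hv : Fintype.card X = v) (hB : ∀ i, (B i).card = 3)
    (h : ∀ p q : X, p ≠ q → (univ.filter fun i => p ∈ B i ∧ q ∈ B i).card = l) :
    IsTripleSystem B v l := by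
  refine ⟨hv, hB, fun S hS => ?_⟩
  obtain ⟨p, q, hpq, rfl⟩ := card_eq_two.1 hS
  rw [← h p q hpq]
  simp [insert_subset_iff]

theorem card_filter_fst {ι : Type*} [Fintype ι] (p : ι → Prop) [DecidablePred p] :
    (univ.filter fun e : ι × Bool => p e.1).card = (univ.filter p).card * 2 := by
  rw [card_filter, Fintype.sum_prod_type_right, card_filter]
  rw [Fintype.sum_bool, mul_two]

/-- A Steiner triple system, doubled with opposite signs, has a zero-sum `2`-flow. -/
theorem IsTripleSystem.existsFlow_two {X ι : Type} [Fintype X] [DecidableEq X] [Fintype ι]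
    {B : ι → Finset X} {v l : ℕ} (h : IsTripleSystem B v l) {n : ℕ} (hn : 2 ≤ n) :
    ExistsTripleSystemWithFlow v (l * 2) n := by
  obtain ⟨hv, hB, hl⟩ := h
  refine ⟨X, inferInstance, inferInstance, ι × Bool, inferInstance, fun i => B i.1, ⟨hv, fun i => hB i.1, fun S hS => ?_⟩,
    fun i => if i.2 then 1 else -1, ?_, fun x => ?_⟩
  · rw [← hl S hS, card_filter_fst fun i => S ⊆ B i]
  · rintro ⟨i, _ | _⟩ <;> simp <;> omega
  · rw [sum_filter, Fintype.sum_prod_type]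
    refine sum_eq_zero fun i _ => ?_
    by_cases hx : x ∈ B i <;> simp [hx]

/-! ### The quasigroup -/

/-- A commutative quasigroup operation on `Fin n`, idempotent for odd `n` and
half-idempotent for even `n`. -/
def midOp {n : ℕ} (x y : Fin n) : Fin n :=
  ⟨(if x.1 + y.1 < n then (x.1 + y.1) / 2 + (x.1 + y.1) % 2 * ((n + 1) / 2)
    else (x.1 + y.1 - n) / 2 + (x.1 + y.1 - n) % 2 * ((n + 1) / 2)), by
    rcases Nat.mod_two_eq_zero_or_one (x.1 + y.1) with h | h <;>
    rcases Nat.mod_two_eq_zero_or_one (x.1 + y.1 - n) with h' | h' <;>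
    rw [h, h'] <;> split_ifs <;> omega⟩

theorem midOp_comm {n : ℕ} (x y : Fin n) : midOp x y = midOp y x := by
  simp only [midOp, add_comm]

/-- With s = x + y mod n, the operation applies the permutation 2a ↦ a, 2a + 1 ↦ a + (n + 1)/2 to s;
for odd n this is halving modulo n. -/
theorem midOp_right_injective {n : ℕ} (x : Fin n) : Function.Injective (midOp x) := by
  intro y z h
  simp only [midOp, Fin.mk.injEq] at h
  rw [Fin.ext_iff]
  rcases Nat.mod_two_eq_zero_or_one (x.1 + y.1) with h1 | h1 <;>
  rcases Nat.mod_two_eq_zero_or_one (x.1 + y.1 - n) with h2 | h2 <;>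
  rcases Nat.mod_two_eq_zero_or_one (x.1 + z.1) with h3 | h3 <;>
  rcases Nat.mod_two_eq_zero_or_one (x.1 + z.1 - n) with h4 | h4 <;>
  rw [h1, h2, h3, h4] at h <;> split_ifs at h <;> omega

theorem exists_midOp_eq {n : ℕ} (x y : Fin n) : ∃ z, midOp x z = y :=
  (Finite.injective_iff_surjective.1 (midOp_right_injective x)) y

/-- For even n, the residue of 2x is always even, so the diagonal covers the lower half twice. -/
theorem val_midOp_self {n : ℕ} (x : Fin n) :
    (midOp x x).1 = if n % 2 = 0 ∧ n ≤ 2 * x.1 then x.1 - n / 2 else x.1 := by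
  simp only [midOp]
  rcases Nat.mod_two_eq_zero_or_one (x.1 + x.1) with h1 | h1 <;>
  rcases Nat.mod_two_eq_zero_or_one (x.1 + x.1 - n) with h2 | h2 <;>
  rw [h1, h2] <;> split_ifs <;> omega

/-! ### Points and mixed blocks -/

/-- The points of both constructions: three copies of `Fin n` and a point at infinity. -/
abbrev ColumnPoint (n : ℕ) : Type := Option (Fin n × Fin 3)

/-- The indices of the mixed blocks: an unordered pair of columns and a level. -/
abbrev MixedIndex (n : ℕ) : Type := {p : Fin n × Fin n // p.1 < p.2} × Fin 3

/-- The block through two points of one level and the point of the next level at their product. -/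
def mixedBlock {n : ℕ} (e : MixedIndex n) : Finset (ColumnPoint n) :=
  {some (e.1.1.1, e.2), some (e.1.1.2, e.2), some (midOp e.1.1.1 e.1.1.2, e.2 + 1)}

theorem fin_three_ne_add_one (i : Fin 3) : i ≠ i + 1 := by revert i; decide

theorem fin_three_ne_add_one_add_one (i : Fin 3) : i ≠ i + 1 + 1 := by revert i; decide

theorem fin_three_cases (i j : Fin 3) : i = j ∨ j = i + 1 ∨ i = j + 1 := by revert i j; decide

theorem card_mixedBlock {n : ℕ} (e : MixedIndex n) : (mixedBlock e).card = 3 := by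
  obtain ⟨⟨⟨x, y⟩, h⟩, i⟩ := e
  refine card_eq_three.2 ⟨_, _, _, ?_, ?_, ?_, rfl⟩ <;> simp
  exact h.ne

theorem mem_mixedBlock {n : ℕ} {e : MixedIndex n} {x : Fin n} {i : Fin 3} :
    some (x, i) ∈ mixedBlock e ↔ (x = e.1.1.1 ∧ i = e.2) ∨ (x = e.1.1.2 ∧ i = e.2) ∨
      (x = midOp e.1.1.1 e.1.1.2 ∧ i = e.2 + 1) := by
  simp [mixedBlock]

theorem none_notMem_mixedBlock {n : ℕ} (e : MixedIndex n) : none ∉ mixedBlock e := by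
  simp [mixedBlock]

theorem mixedBlock_same_level {n : ℕ} {x y : Fin n} (h : x < y) (i : Fin 3) (e : MixedIndex n) :
    some (x, i) ∈ mixedBlock e ∧ some (y, i) ∈ mixedBlock e ↔ e = (⟨(x, y), h⟩, i) := by
  obtain ⟨⟨⟨a, b⟩, hab⟩, k⟩ := e
  have := fin_three_ne_add_one k
  simp only [mem_mixedBlock, Prod.mk.injEq, Subtype.mk.injEq]
  simp only at hab
  grind

/-- Since i + 2 ≠ i in `Fin 3`, only the block's third point can lie at level i + 1. The other
column z is then the unique solution of x ∘ z = y, and z ≠ x because y is off the diagonal. -/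
theorem mixedBlock_next_level {n : ℕ} {x y : Fin n} (h : y ≠ midOp x x) (i : Fin 3) :
    ∃ e₀ : MixedIndex n, ∀ e : MixedIndex n,
      some (x, i) ∈ mixedBlock e ∧ some (y, i + 1) ∈ mixedBlock e ↔ e = e₀ := by
  obtain ⟨z, rfl⟩ := exists_midOp_eq x y
  have hz : z ≠ x := by rintro rfl; exact h rfl
  have key : ∀ e : MixedIndex n, some (x, i) ∈ mixedBlock e ∧
      some (midOp x z, i + 1) ∈ mixedBlock e ↔
      e.2 = i ∧ (e.1.1 = (x, z) ∨ e.1.1 = (z, x)) := by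
    rintro ⟨⟨⟨a, b⟩, hab⟩, k⟩
    have h1 := fin_three_ne_add_one
    have h2 := fin_three_ne_add_one_add_one
    have h3 := @midOp_right_injective n
    have h4 := midOp_comm (n := n)
    simp only [mem_mixedBlock, Prod.mk.injEq]
    simp only at hab
    constructor
    · rintro ⟨h5 | h5 | h5, h6 | h6 | h6⟩
      all_goals obtain ⟨rfl, rfl⟩ := h5
      all_goals obtain ⟨h6, h7⟩ := h6
      all_goals first
        | exact absurd h7.symm (h1 _)
        | exact absurd h7.symm (h2 _)
        | skip
      · exact ⟨rfl, Or.inl ⟨rfl, (h3 _ h6).symm⟩⟩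
      · exact ⟨rfl, Or.inr ⟨(h3 _ (h6.trans (h4 _ _))).symm, rfl⟩⟩
    · rintro ⟨rfl, ⟨rfl, rfl⟩ | ⟨rfl, rfl⟩⟩
      · simp
      · simp [h4 a b]
  rcases lt_or_gt_of_ne hz with hlt | hlt
  · refine ⟨(⟨(z, x), hlt⟩, i), fun e => (key e).trans ?_⟩
    obtain ⟨⟨⟨a, b⟩, hab⟩, k⟩ := e
    simp only [Prod.mk.injEq, Subtype.mk.injEq]
    simp only at hab
    grind
  · refine ⟨(⟨(x, z), hlt⟩, i), fun e => (key e).trans ?_⟩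
    obtain ⟨⟨⟨a, b⟩, hab⟩, k⟩ := e
    simp only [Prod.mk.injEq, Subtype.mk.injEq]
    simp only at hab
    grind

theorem mixedBlock_diagonal {n : ℕ} (x : Fin n) (i : Fin 3) (e : MixedIndex n) :
    ¬ (some (x, i) ∈ mixedBlock e ∧ some (midOp x x, i + 1) ∈ mixedBlock e) := by
  obtain ⟨⟨⟨a, b⟩, hab⟩, k⟩ := e
  have h1 := fin_three_ne_add_one
  have h2 := fin_three_ne_add_one_add_one
  have h3 := @midOp_right_injective n
  have h4 := midOp_comm (n := n)
  simp only [mem_mixedBlock]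
  simp only at hab
  rintro ⟨h5 | h5 | h5, h6 | h6 | h6⟩
  all_goals obtain ⟨rfl, rfl⟩ := h5
  all_goals obtain ⟨h6, h7⟩ := h6
  all_goals first
    | exact h1 _ h7.symm
    | exact h2 _ h7.symm
    | skip
  · exact hab.ne (h3 _ h6)
  · exact hab.ne' (h3 _ (h6.trans (h4 _ _)))

/-- To prove a symmetric relation for all pairs of distinct points it is enough to treat
points of equal level, points of consecutive levels and the point at infinity. -/
theorem ColumnPoint.pair_induction {n : ℕ} {P : ColumnPoint n → ColumnPoint n → Prop}
    (symm : ∀ p q, P p q → P q p)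
    (infty : ∀ x i, P none (some (x, i)))
    (same : ∀ x y i, x < y → P (some (x, i)) (some (y, i)))
    (next : ∀ x y i, P (some (x, i)) (some (y, i + 1)))
    (p q : ColumnPoint n) (hpq : p ≠ q) : P p q := by
  rcases p with _ | ⟨x, i⟩ <;> rcases q with _ | ⟨y, j⟩
  · exact absurd rfl hpq
  · exact infty y j
  · exact symm _ _ (infty x i)
  · rcases fin_three_cases i j with rfl | rfl | rfl
    · rcases lt_trichotomy x y with h | rfl | h
      · exact same _ _ _ h
      · exact absurd rfl hpq
      · exact symm _ _ (same _ _ _ h)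
    · exact next _ _ _
    · exact symm _ _ (next _ _ _)

theorem card_columnPoint (n : ℕ) : Fintype.card (ColumnPoint n) = 3 * n + 1 := by
  simp [mul_comm]

theorem card_filter_eq_one {ι : Type*} [Fintype ι] {p : ι → Prop} [DecidablePred p] {a : ι}
    (h : ∀ i, p i ↔ i = a) : (univ.filter p).card = 1 :=
  card_eq_one.2 ⟨a, by ext i; simp [h]⟩

theorem card_filter_eq_zero {ι : Type*} [Fintype ι] {p : ι → Prop} [DecidablePred p]
    (h : ∀ i, ¬ p i) : (univ.filter p).card = 0 :=
  card_eq_zero.2 (by ext i; simp [h])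

theorem card_filter_pair_sum_elim {X ι κ : Type*} [DecidableEq X] [Fintype ι] [Fintype κ]
    (B : ι → Finset X) (C : κ → Finset X) (p q : X) :
    (univ.filter fun i => p ∈ Sum.elim B C i ∧ q ∈ Sum.elim B C i).card =
      (univ.filter fun i => p ∈ B i ∧ q ∈ B i).card +
        (univ.filter fun i => p ∈ C i ∧ q ∈ C i).card := by
  simp only [card_filter, Fintype.sum_sum_type]
  rfl

/-! ### Skolem's Steiner triple systems -/

/-- The vertical blocks and the blocks through infinity in Skolem's construction. -/
def skolemBlock {t : ℕ} : Fin t × Option (Fin 3) → Finset (ColumnPoint (2 * t))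
  | (x, none) => {some (⟨x.1, by omega⟩, 0), some (⟨x.1, by omega⟩, 1), some (⟨x.1, by omega⟩, 2)}
  | (x, some i) => {none, some (⟨x.1 + t, by omega⟩, i), some (⟨x.1, by omega⟩, i + 1)}

theorem mem_skolemBlock {t : ℕ} {x : Fin (2 * t)} {i : Fin 3} {e : Fin t × Option (Fin 3)} :
    some (x, i) ∈ skolemBlock e ↔ (e.2 = none ∧ x.1 = e.1.1) ∨
      (e.2 = some i ∧ x.1 = e.1.1 + t) ∨ ∃ j, e.2 = some j ∧ i = j + 1 ∧ x.1 = e.1.1 := by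
  obtain ⟨y, _ | j⟩ := e
  · have : i = 0 ∨ i = 1 ∨ i = 2 := by revert i; decide
    simp only [skolemBlock, mem_insert, mem_singleton, Option.some.injEq, Prod.mk.injEq,
      Fin.ext_iff]
    simp only [← Fin.ext_iff]
    grind
  · simp only [skolemBlock, mem_insert, mem_singleton, Option.some.injEq, Prod.mk.injEq,
      Fin.ext_iff]
    simp only [← Fin.ext_iff]
    grind

theorem none_mem_skolemBlock {t : ℕ} {e : Fin t × Option (Fin 3)} :
    none ∈ skolemBlock e ↔ e.2 ≠ none := by
  obtain ⟨y, _ | j⟩ := e <;> simp [skolemBlock]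

theorem card_skolemBlock {t : ℕ} (e : Fin t × Option (Fin 3)) : (skolemBlock e).card = 3 := by
  obtain ⟨x, _ | i⟩ := e
  · refine card_eq_three.2 ⟨_, _, _, ?_, ?_, ?_, rfl⟩ <;> simp
  · refine card_eq_three.2 ⟨_, _, _, ?_, ?_, ?_, rfl⟩ <;> simp

theorem skolemBlock_same_level {t : ℕ} {x y : Fin (2 * t)} (h : x < y) (i : Fin 3)
    (e : Fin t × Option (Fin 3)) :
    ¬ (some (x, i) ∈ skolemBlock e ∧ some (y, i) ∈ skolemBlock e) := by
  have := fin_three_ne_add_one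
  simp only [mem_skolemBlock]
  grind

theorem skolemBlock_next_level {t : ℕ} {x y : Fin (2 * t)} (h : y ≠ midOp x x) (i : Fin 3)
    (e : Fin t × Option (Fin 3)) :
    ¬ (some (x, i) ∈ skolemBlock e ∧ some (y, i + 1) ∈ skolemBlock e) := by
  have h1 := fin_three_ne_add_one
  have h2 := fin_three_ne_add_one_add_one
  have h3 := val_midOp_self x
  have h4 : y.1 ≠ (midOp x x).1 := fun h' => h (Fin.ext h')
  rw [h3] at h4
  have := e.1.2
  simp only [mem_skolemBlock]
  grind

/-- The diagonal fixes the lower half, where the vertical block serves, and shifts the upper half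
down by t, where a block through infinity does. -/
theorem skolemBlock_diagonal {t : ℕ} (x : Fin (2 * t)) (i : Fin 3) :
    ∃ e₀, ∀ e : Fin t × Option (Fin 3),
      some (x, i) ∈ skolemBlock e ∧ some (midOp x x, i + 1) ∈ skolemBlock e ↔ e = e₀ := by
  have h1 := fin_three_ne_add_one
  have h2 := fin_three_ne_add_one_add_one
  have h3 := val_midOp_self x
  by_cases hx : x.1 < t
  · rw [if_neg (by omega)] at h3
    refine ⟨(⟨x.1, hx⟩, none), fun ⟨y, e⟩ => ?_⟩
    simp only [mem_skolemBlock, h3, Prod.mk.injEq, Fin.ext_iff (a := y)]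
    have := y.2
    grind
  · rw [if_pos (by omega)] at h3
    refine ⟨(⟨x.1 - t, by omega⟩, some i), fun ⟨y, e⟩ => ?_⟩
    simp only [mem_skolemBlock, h3, Prod.mk.injEq, Fin.ext_iff (a := y)]
    have := y.2
    grind

theorem skolemBlock_infty {t : ℕ} (x : Fin (2 * t)) (i : Fin 3) :
    ∃ e₀, ∀ e : Fin t × Option (Fin 3),
      none ∈ skolemBlock e ∧ some (x, i) ∈ skolemBlock e ↔ e = e₀ := by
  by_cases hx : x.1 < t
  · obtain ⟨j, rfl⟩ : ∃ j, i = j + 1 := ⟨i - 1, by simp⟩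
    refine ⟨(⟨x.1, hx⟩, some j), fun ⟨y, e⟩ => ?_⟩
    simp only [mem_skolemBlock, none_mem_skolemBlock, Prod.mk.injEq, Fin.ext_iff (a := y)]
    have := y.2
    grind
  · refine ⟨(⟨x.1 - t, by omega⟩, some i), fun ⟨y, e⟩ => ?_⟩
    simp only [mem_skolemBlock, none_mem_skolemBlock, Prod.mk.injEq, Fin.ext_iff (a := y)]
    have := y.2
    grind

/-- Skolem's construction of a Steiner triple system of order `6 t + 1`. -/
theorem isTripleSystem_skolem (t : ℕ) :
    IsTripleSystem (Sum.elim mixedBlock skolemBlock :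
      MixedIndex (2 * t) ⊕ Fin t × Option (Fin 3) → Finset (ColumnPoint (2 * t)))
      (6 * t + 1) 1 := by
  refine .of_pairs ((card_columnPoint _).trans (by ring)) ?_ ?_
  · rintro (e | e)
    · exact card_mixedBlock e
    · exact card_skolemBlock e
  refine ColumnPoint.pair_induction (fun p q h => ?_) (fun x i => ?_) (fun x y i h => ?_)
    (fun x y i => ?_)
  · simpa only [and_comm] using h
  all_goals rw [card_filter_pair_sum_elim]
  · obtain ⟨e, he⟩ := skolemBlock_infty x i
    rw [card_filter_eq_zero fun e h => none_notMem_mixedBlock e h.1, card_filter_eq_one he]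
  · rw [card_filter_eq_one (mixedBlock_same_level h i),
      card_filter_eq_zero (skolemBlock_same_level h i)]
  · by_cases h : y = midOp x x
    · subst h
      obtain ⟨e, he⟩ := skolemBlock_diagonal x i
      rw [card_filter_eq_zero (mixedBlock_diagonal x i), card_filter_eq_one he]
    · obtain ⟨e, he⟩ := mixedBlock_next_level h i
      rw [card_filter_eq_one he, card_filter_eq_zero (skolemBlock_next_level h i)]

/-! ### Bose's twofold triple systems -/

/-- All triples in the union of a column and the point at infinity. -/
def columnBlock {n : ℕ} : Fin n × Option (Fin 3) → Finset (ColumnPoint n)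
  | (x, none) => {some (x, 0), some (x, 1), some (x, 2)}
  | (x, some i) => {none, some (x, i), some (x, i + 1)}

/-- The block through infinity indexed by j misses only level j + 2, and i = j + 2 means j = i + 1.
-/
theorem mem_columnBlock {n : ℕ} {x : Fin n} {i : Fin 3} {e : Fin n × Option (Fin 3)} :
    some (x, i) ∈ columnBlock e ↔ x = e.1 ∧ e.2 ≠ some (i + 1) := by
  obtain ⟨y, e⟩ := e
  have : ∀ i j : Fin 3, (i = j ∨ i = j + 1) ↔ j ≠ i + 1 := by decide
  rcases e with _ | j
  · have : i = 0 ∨ i = 1 ∨ i = 2 := by revert i; decide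
    simp [columnBlock]
    tauto
  · simp only [columnBlock, mem_insert, mem_singleton, Option.some.injEq, Prod.mk.injEq,
      reduceCtorEq, false_or, ne_eq]
    rw [← and_or_left, this]

theorem none_mem_columnBlock {n : ℕ} {e : Fin n × Option (Fin 3)} :
    none ∈ columnBlock e ↔ e.2 ≠ none := by
  obtain ⟨y, _ | j⟩ := e <;> simp [columnBlock]

theorem card_columnBlock {n : ℕ} (e : Fin n × Option (Fin 3)) : (columnBlock e).card = 3 := by
  obtain ⟨x, _ | i⟩ := e
  · refine card_eq_three.2 ⟨_, _, _, ?_, ?_, ?_, rfl⟩ <;> simp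
  · refine card_eq_three.2 ⟨_, _, _, ?_, ?_, ?_, rfl⟩ <;> simp

theorem card_filter_column {n : ℕ} (x : Fin n) (p : Option (Fin 3) → Prop) [DecidablePred p] :
    (univ.filter fun e : Fin n × Option (Fin 3) => x = e.1 ∧ p e.2).card =
      (univ.filter p).card := by
  have : (univ.filter fun e : Fin n × Option (Fin 3) => x = e.1 ∧ p e.2) =
      {x} ×ˢ univ.filter p := by
    ext ⟨y, e⟩
    simp [eq_comm, and_comm]
  rw [this, card_product, card_singleton, one_mul]

theorem card_columnBlock_infty {n : ℕ} (x : Fin n) (i : Fin 3) :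
    (univ.filter fun e : Fin n × Option (Fin 3) =>
      none ∈ columnBlock e ∧ some (x, i) ∈ columnBlock e).card = 2 := by
  simp only [none_mem_columnBlock, mem_columnBlock, and_left_comm (b := x = _)]
  rw [card_filter_column x fun e => e ≠ none ∧ e ≠ some (i + 1)]
  revert i
  decide

theorem card_columnBlock_next_level {n : ℕ} (x : Fin n) (i : Fin 3) :
    (univ.filter fun e : Fin n × Option (Fin 3) =>
      some (x, i) ∈ columnBlock e ∧ some (x, i + 1) ∈ columnBlock e).card = 2 := by
  simp only [mem_columnBlock, ← and_and_left]
  rw [card_filter_column x fun e => e ≠ some (i + 1) ∧ e ≠ some (i + 1 + 1)]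
  revert i
  decide

theorem columnBlock_ne {n : ℕ} {x y : Fin n} (h : x ≠ y) (i j : Fin 3)
    (e : Fin n × Option (Fin 3)) :
    ¬ (some (x, i) ∈ columnBlock e ∧ some (y, j) ∈ columnBlock e) := by
  simp only [mem_columnBlock]
  rintro ⟨⟨rfl, _⟩, rfl, _⟩
  exact h rfl

/-- A twofold triple system of order `3 n + 1`, for odd `n`. -/
theorem isTripleSystem_bose {n : ℕ} (hn : n % 2 = 1) :
    IsTripleSystem (Sum.elim (fun e => mixedBlock e.1) columnBlock :
      MixedIndex n × Bool ⊕ Fin n × Option (Fin 3) → Finset (ColumnPoint n)) (3 * n + 1) 2 := by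
  have hmid : ∀ x : Fin n, midOp x x = x := fun x =>
    Fin.ext ((val_midOp_self x).trans (if_neg (by omega)))
  refine .of_pairs (card_columnPoint _) ?_ ?_
  · rintro (e | e)
    · exact card_mixedBlock e.1
    · exact card_columnBlock e
  refine ColumnPoint.pair_induction (fun p q h => ?_) (fun x i => ?_) (fun x y i h => ?_)
    (fun x y i => ?_)
  · simpa only [and_comm] using h
  all_goals rw [card_filter_pair_sum_elim]
  · rw [card_filter_eq_zero fun e h => none_notMem_mixedBlock e.1 h.1, card_columnBlock_infty]
  · rw [card_filter_fst fun e => some (x, i) ∈ mixedBlock e ∧ some (y, i) ∈ mixedBlock e,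
      card_filter_eq_one (mixedBlock_same_level h i),
      card_filter_eq_zero (columnBlock_ne h.ne i i)]
  · rw [card_filter_fst fun e => some (x, i) ∈ mixedBlock e ∧ some (y, i + 1) ∈ mixedBlock e]
    by_cases h : y = x
    · subst h
      have := mixedBlock_diagonal y i
      rw [hmid] at this
      rw [card_filter_eq_zero this, card_columnBlock_next_level]
    · obtain ⟨e, he⟩ := mixedBlock_next_level (x := x) (y := y) (by rwa [hmid]) i
      rw [card_filter_eq_one he, card_filter_eq_zero (columnBlock_ne (Ne.symm h) _ _)]

/-! ### The zero-sum 5-flow -/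

/-- The sequence `-2, 1, 1, -1, 1, -1, 1, …`, of value `-2` at `0`. -/
def columnWeight (m : ℕ) : ℤ :=
  if m = 0 then -2 else if m = 1 then 1 else (-1) ^ m

theorem columnWeight_mem (m : ℕ) :
    columnWeight m = -2 ∨ columnWeight m = 1 ∨ columnWeight m = -1 := by
  unfold columnWeight
  split_ifs
  · simp
  · simp
  · exact Or.inr (neg_one_pow_eq_or ℤ m)

/-- The terms -2, 1, 1 cancel, and the rest cancel in pairs. An odd number of ±1 alone could not sum
to zero. -/
theorem sum_range_columnWeight (k : ℕ) : ∑ m ∈ range (2 * k + 3), columnWeight m = 0 := by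
  induction k with
  | zero => decide
  | succ k ih =>
    rw [show 2 * (k + 1) + 3 = 2 * k + 3 + 1 + 1 by ring, sum_range_succ, sum_range_succ, ih]
    simp [columnWeight, pow_succ]

/-- The values on the blocks in a column: `w` on the blocks through infinity, `-2 w` on the
remaining one. -/
def columnFlow {n : ℕ} (e : Fin n × Option (Fin 3)) : ℤ :=
  if e.2 = none then -2 * columnWeight e.1.1 else columnWeight e.1.1

/-- The bound 4 is attained on the vertical block of column 0, whose weight is -2. -/
theorem abs_columnFlow {n : ℕ} (e : Fin n × Option (Fin 3)) :
    1 ≤ |columnFlow e| ∧ |columnFlow e| ≤ 4 := by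
  unfold columnFlow
  rcases columnWeight_mem e.1.1 with h | h | h <;> rw [h] <;> split_ifs <;> decide

theorem sum_columnFlow {k : ℕ} (p : ColumnPoint (2 * k + 3)) :
    ∑ e : Fin (2 * k + 3) × Option (Fin 3),
      (if p ∈ columnBlock e then columnFlow e else 0) = 0 := by
  rw [Fintype.sum_prod_type]
  rcases p with _ | ⟨x, i⟩
  · simp only [none_mem_columnBlock, columnFlow, Fintype.sum_option]
    simp only [ne_eq, not_true_eq_false, reduceCtorEq, not_false_eq_true, if_true, if_false,
      sum_const, card_univ, Fintype.card_fin, zero_add]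
    rw [← smul_sum, Fin.sum_univ_eq_sum_range, sum_range_columnWeight, smul_zero]
  · refine sum_eq_zero fun y _ => ?_
    simp only [mem_columnBlock, columnFlow, Fintype.sum_option, Fin.sum_univ_three]
    by_cases h : x = y
    · have : i = 0 ∨ i = 1 ∨ i = 2 := by revert i; decide
      rcases this with rfl | rfl | rfl <;> simp [h] <;> ring
    · simp [h]

theorem existsTripleSystemWithFlow_five (k : ℕ) :
    ExistsTripleSystemWithFlow (3 * (2 * k + 3) + 1) 2 5 := by
  refine ⟨_, _, _, _, _, _, isTripleSystem_bose (n := 2 * k + 3) (by omega),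
    Sum.elim (fun e => if e.2 then 1 else -1) columnFlow, ?_, fun p => ?_⟩
  · rintro (⟨e, _ | _⟩ | e)
    · simp
    · simp
    · simpa using abs_columnFlow e
  · rw [sum_filter, Fintype.sum_sum_type]
    refine (congrArg₂ (· + ·) ?_ (sum_columnFlow p)).trans (add_zero 0)
    rw [Fintype.sum_prod_type]
    refine sum_eq_zero fun e _ => ?_
    by_cases h : p ∈ mixedBlock e <;> simp [h]

theorem mainTheorem2 :
    (∀ v l : ℕ, v ≡ 4 [MOD 6] → v ≠ 4 → (l ≡ 2 [MOD 6] ∨ l ≡ 4 [MOD 6]) →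
      ExistsTripleSystemWithFlow v l 5) ∧
    (∀ v l : ℕ, v ≡ 1 [MOD 6] → v ≠ 7 → v ≠ 19 → (l ≡ 2 [MOD 6] ∨ l ≡ 4 [MOD 6]) →
      ExistsTripleSystemWithFlow v l 3) := by
  have even_of_mod : ∀ l : ℕ, l ≡ 2 [MOD 6] ∨ l ≡ 4 [MOD 6] → ∃ m, l = 2 * m := by
    intro l hl
    simp only [Nat.ModEq] at hl
    exact ⟨l / 2, by omega⟩
  refine ⟨fun v l hv hv4 hl => ?_, fun v l hv _ _ hl => ?_⟩ <;>
    obtain ⟨m, rfl⟩ := even_of_mod l hl <;> simp only [Nat.ModEq] at hv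
  -- Here v = 6k + 10; excluding v = 4 excludes a single column, whose nonzero weight could not
  -- cancel at infinity.
  · obtain ⟨k, rfl⟩ : ∃ k, v = 3 * (2 * k + 3) + 1 := ⟨v / 6 - 1, by omega⟩
    exact (existsTripleSystemWithFlow_five k).mul m
  · obtain ⟨t, rfl⟩ : ∃ t, v = 6 * t + 1 := ⟨v / 6, by omega⟩
    exact ((isTripleSystem_skolem t).existsFlow_two (by norm_num)).mul m
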